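/- Notation. $\|\cdot\|$ is the Euclidean norm. For $\delta>0$ let $q_\delta(t)=n\delta$ if $t\in(n\delta-\delta/2,\,n\delta+\delta/2]$, $n\in\mathbb{Z}$, and let $Q=Q_\delta$ apply $q_\delta$ to every coordinate of a vector. For a real random variable $z$ put $\|z\|_{\psi_2}=\sup_{p\ge1}p^{-1/2}(\mathbb{E}|z|^p)^{1/p}$ and for a random vector $Y$ in $\mathbb{R}^k$ put $\|Y\|_{\psi_2}=\sup_{\|z\|=1}\|\langle Y,z\rangle\|_{\psi_2}$; $Y$ is sub-Gaussian if this is finite, and isotropic if $\mathbb{E}\langle Y,z\rangle^2=\|z\|^2$ for all $z\in\mathbb{R}^k$. For a matrix $E$ of full column rank, $E^\dagger=(E^TE)^{-1}E^T$. Theorem. There is an absolute constant $C>0$, and for every $K>0$ there are constants $c_K>0$ and $c_3>0$ depending only on $K$, such that the following holds. Let $k\ge3$, let $m$ be an integer with $\lambda:=m/k>1$, let $\delta>0$, let $x\in\mathbb{R}^k$ be fixed, and let $E$ be a random $m\times k$ matrix with independent isotropic sub-Gaussian rows whose $\psi_2$-norms do not exceed $K$. Put $$\mu=\tfrac1m\big\|\mathbb{E}\,E^T(Ex-Q(Ex))\big\|,\qquad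 A=\big(\tfrac12-c_K\lambda^{-1/2}\big)^{-2},\qquad A'=\big(\tfrac32+c_K\lambda^{-1/2}\big)^{-2}.$$ For every $c_2\in(0,1)$, with $c_1=CK\sqrt{\ln(e^2c_2^{-1})}$, with probability at least $1-c_2-2e^{-c_3m}$ both of the following hold: (i) if $E$ has full column rank, then $$\|x-E^\dagger Q(Ex)\|>A'\big(\mu-c_1\sqrt{\log k}\,\lambda^{-1/2}\delta\big);$$ (ii) if $\lambda>(2c_K)^2$ (that is, $\tfrac12-c_K\lambda^{-1/2}>0$), then $E$ has full column rank and $$\|x-E^\dagger Q(Ex)\|<A\big(\mu+c_1\sqrt{\log k}\,\lambda^{-1/2}\delta\big).$$ -/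

import Mathlib

open MeasureTheory ProbabilityTheory
open scoped ENNReal Matrix

namespace MSQ

/-- The uniform scalar quantizer with step size `δ`: the value is `n * δ` on
`(n * δ - δ / 2, n * δ + δ / 2]`, see `scalarQuantizer_eq_iff`. -/
noncomputable def scalarQuantizer (δ t : ℝ) : ℝ := (⌈t / δ - 1 / 2⌉ : ℤ) * δ

theorem scalarQuantizer_eq_iff {δ : ℝ} (hδ : 0 < δ) (t : ℝ) (n : ℤ) :
    scalarQuantizer δ t = n * δ ↔ t ∈ Set.Ioc (n * δ - δ / 2) (n * δ + δ / 2) := by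
  have h : scalarQuantizer δ t = n * δ ↔ ⌈t / δ - 1 / 2⌉ = n := by
    unfold scalarQuantizer
    rw [mul_left_inj' hδ.ne']
    exact Int.cast_inj
  have e : t = (t / δ) * δ := by field_simp
  rw [h, Int.ceil_eq_iff, Set.mem_Ioc]
  constructor
  · rintro ⟨h1, h2⟩
    constructor <;> nlinarith
  · rintro ⟨h1, h2⟩
    constructor
    · by_contra hc
      nlinarith
    · by_contra hc
      nlinarith

/-- Memoryless scalar quantization with step size `δ`: every coordinate is quantized separately. -/
noncomputable def quantize (δ : ℝ) {m : ℕ} (u : Fin m → ℝ) : Fin m → ℝ :=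
  fun j => scalarQuantizer δ (u j)

/-- The Moore-Penrose pseudoinverse `(EᵀE)⁻¹Eᵀ` of a matrix `E` of full column rank.
It has its intended meaning only for such matrices. -/
noncomputable def pinv {m k : ℕ} (E : Matrix (Fin m) (Fin k) ℝ) : Matrix (Fin k) (Fin m) ℝ :=
  (Eᵀ * E)⁻¹ * Eᵀ

theorem pinv_mul_self {m k : ℕ} (E : Matrix (Fin m) (Fin k) ℝ) (h : E.rank = k) :
    pinv E * E = 1 := by
  have h1 : (Eᵀ * E).rank = Fintype.card (Fin k) := by
    rw [Matrix.rank_transpose_mul_self, h, Fintype.card_fin]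
  have h2 : IsUnit (Eᵀ * E) := by
    rw [← Matrix.linearIndependent_rows_iff_isUnit]
    exact linearIndependent_iff_card_eq_finrank_span.2
      (by rw [← h1, Matrix.rank_eq_finrank_span_row]; rfl)
  rw [pinv, Matrix.mul_assoc]
  exact Matrix.nonsing_inv_mul _ ((Matrix.isUnit_iff_isUnit_det _).1 h2)

/-- The reconstruction error `‖x - E† Q(E x)‖` in the Euclidean norm. -/
noncomputable def reconError (δ : ℝ) {m k : ℕ} (E : Matrix (Fin m) (Fin k) ℝ)
    (x : Fin k → ℝ) : ℝ :=
  ‖WithLp.toLp 2 (x - pinv E *ᵥ quantize δ (E *ᵥ x))‖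

section Random

variable {Ω : Type*} [MeasurableSpace Ω]

/-- The sub-Gaussian norm `sup_{p ≥ 1} p^{-1/2} (𝔼|z|^p)^{1/p}` of a real random variable;
it is finite exactly when `z` is sub-Gaussian. -/
noncomputable def psi2Norm (P : Measure Ω) (z : Ω → ℝ) : ℝ≥0∞ :=
  ⨆ (p : ℝ) (_ : 1 ≤ p), ENNReal.ofReal (p ^ (-(1 / 2) : ℝ)) * eLpNorm z (ENNReal.ofReal p) P

/-- The sub-Gaussian norm of a random vector: the supremum of the sub-Gaussian norms of its
one-dimensional marginals in unit directions. -/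
noncomputable def psi2NormVec (P : Measure Ω) {n : ℕ} (Y : Ω → EuclideanSpace ℝ (Fin n)) : ℝ≥0∞ :=
  ⨆ z ∈ Metric.sphere (0 : EuclideanSpace ℝ (Fin n)) 1, psi2Norm P (fun ω => inner ℝ (Y ω) z)

/-- A random vector `Y` is isotropic if `𝔼 ⟨Y, z⟩² = ‖z‖²` for all `z`. -/
def IsIsotropic (P : Measure Ω) {n : ℕ} (Y : Ω → EuclideanSpace ℝ (Fin n)) : Prop :=
  ∀ z : EuclideanSpace ℝ (Fin n), ∫ ω, (inner ℝ (Y ω) z) ^ 2 ∂P = ‖z‖ ^ 2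

/-- The `j`-th row of a random matrix, as a random vector in Euclidean space. -/
def row {m k : ℕ} (E : Ω → Matrix (Fin m) (Fin k) ℝ) (j : Fin m) (ω : Ω) :
    EuclideanSpace ℝ (Fin k) :=
  WithLp.toLp 2 (E ω j)

/-- `E` is a random matrix with independent isotropic sub-Gaussian rows whose `ψ₂`-norms are
at most `K`. -/
structure IsSubGaussianFrame (P : Measure Ω) {m k : ℕ} (E : Ω → Matrix (Fin m) (Fin k) ℝ)
    (K : ℝ) : Prop where
  measurable_row : ∀ j, Measurable (row E j)
  indep : iIndepFun (row E) P
  isotropic : ∀ j, IsIsotropic P (row E j)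
  psi2_le : ∀ j, psi2NormVec P (row E j) ≤ ENNReal.ofReal K

/-- The bias `μ = (1/m) ‖𝔼 Eᵀ(Ex - Q(Ex))‖`. -/
noncomputable def bias (P : Measure Ω) (δ : ℝ) {m k : ℕ} (E : Ω → Matrix (Fin m) (Fin k) ℝ)
    (x : Fin k → ℝ) : ℝ :=
  1 / (m : ℝ) *
    ‖∫ ω, WithLp.toLp 2 ((E ω)ᵀ *ᵥ (E ω *ᵥ x - quantize δ (E ω *ᵥ x))) ∂P‖

end Random

/-- `A = (1/2 - c_K λ^{-1/2})^{-2}`. -/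
noncomputable def upperConst (cK lam : ℝ) : ℝ := (1 / 2 - cK * lam ^ (-(1 / 2) : ℝ)) ^ (-2 : ℤ)

/-- `A' = (3/2 + c_K λ^{-1/2})^{-2}`. -/
noncomputable def lowerConst (cK lam : ℝ) : ℝ := (3 / 2 + cK * lam ^ (-(1 / 2) : ℝ)) ^ (-2 : ℤ)

/-- The deviation term `c₁ √(log k) λ^{-1/2} δ` with `c₁ = C K √(log (e² / c₂))`. -/
noncomputable def deviation (C K c₂ δ lam : ℝ) (k : ℕ) : ℝ :=
  C * K * √(Real.log (Real.exp 2 * c₂⁻¹)) * √(Real.log k) * lam ^ (-(1 / 2) : ℝ) * δ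

end MSQ

/-!
With `w = Eᵀ (E x - Q (E x))` and `r = x - E† Q (E x)`, the normal equations read `EᵀE r = w` as soon
as `E` has full column rank. Hence the theorem splits into two concentration statements: `w` is close
to its mean, whose norm is `m μ`, and `EᵀE / m` is close to the identity.

The `i`-th coordinate of `w` is a sum of independent terms, each a marginal of a row times a
quantization error of size at most `δ / 2`. Each term is therefore sub-Gaussian at scale `K δ`
(`integrable_exp_rowTerm_sq`), stays so after centering (`mgf_sub_integral_le`), and a Chernoff bound
followed by a union bound over the `k` coordinates gives a deviation of
`w` of order `K δ √(m k log k log (e² / c₂))` outside an event of probability `c₂`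
(`measure_deviation_le`).

For `T = EᵀE / m - 1` the forms `⟨T u, y⟩` are averages of independent centered products of two
sub-Gaussian variables. Those have exponential moments, and Bernstein's method gives tails
`2 exp (-κ m s)` for `s` bounded below (`exists_measure_sum_inner_le`). Testing on a `1 / 2`-net of the
unit ball with at most `5 ^ k` points bounds `‖T‖` (`exists_net`, `opNorm_le_of_net`); the entropy of
the net is absorbed by enlarging the threshold to `t = 3 / 4 + L / λ`
(`exists_measure_norm_covDev_le`).

On the intersection of the two events `m (1 - t) ‖r‖ ≤ ‖w‖ ≤ m (1 + t) ‖r‖`. The choice `c_K = √L`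
makes `1 + t ≤ (3 / 2 + c_K λ^(-1/2))²` always, and `(1 / 2 - c_K λ^(-1/2))² ≤ 1 - t` when
`λ > (2 c_K)²`; in the latter case `‖T‖ ≤ t < 1` also forces full column rank.

In both concentration statements the passage from the moments in the definition of the `ψ₂`-norm to
`𝔼 exp (⟨Y, u⟩² / (12 K²)) ≤ 2` is `integrable_exp_inner_sq`.
-/

namespace MSQ

/-! ### Elementary exponential inequality -/

/-- The quadratic remainder is what makes the moment generating function of a centered variable
differ from `1` only to second order. -/
theorem exp_le_one_add_add_sq_mul_exp_abs (x : ℝ) :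
    Real.exp x ≤ 1 + x + x ^ 2 * Real.exp |x| := by
  have h := Complex.norm_exp_sub_sum_le_norm_mul_exp (x : ℂ) 2
  have e : Complex.exp (x : ℂ) - ∑ m ∈ Finset.range 2, (x : ℂ) ^ m / (m.factorial : ℂ)
      = ((Real.exp x - (1 + x) : ℝ) : ℂ) := by
    simp [Finset.sum_range_succ]
  rw [e, Complex.norm_real, Complex.norm_real, Real.norm_eq_abs, Real.norm_eq_abs, sq_abs] at h
  linarith [le_abs_self (Real.exp x - (1 + x))]

/-! ### Exponential moments -/

section Moments

variable {Ω : Type*} [MeasurableSpace Ω] {P : Measure Ω}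

/-- Only the even integer exponents `p = 2 n` in the `ψ₂`-norm are needed. -/
theorem lintegral_pow_le_of_psi2Norm_le {z : Ω → ℝ} {K : ℝ} (hK : 0 < K)
    (h : psi2Norm P z ≤ ENNReal.ofReal K) {n : ℕ} (hn : 1 ≤ n) :
    ∫⁻ ω, ENNReal.ofReal ((z ω ^ 2) ^ n) ∂P ≤ ENNReal.ofReal ((K ^ 2 * (2 * n)) ^ n) := by
  have hn' : (1 : ℝ) ≤ n := by exact_mod_cast hn
  set p : ℝ := 2 * n with hp
  have hp1 : 1 ≤ p := by linarith
  have hp0 : 0 < p := by linarith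
  have h1 : ENNReal.ofReal (p ^ (-(1 / 2) : ℝ)) * eLpNorm z (ENNReal.ofReal p) P
      ≤ ENNReal.ofReal K :=
    le_trans (le_iSup₂ (f := fun (p : ℝ) (_ : 1 ≤ p) =>
      ENNReal.ofReal (p ^ (-(1 / 2) : ℝ)) * eLpNorm z (ENNReal.ofReal p) P) p hp1) h
  have h2 : eLpNorm z (ENNReal.ofReal p) P ≤ ENNReal.ofReal (p ^ (1 / 2 : ℝ) * K) := by
    calc eLpNorm z (ENNReal.ofReal p) P
        = ENNReal.ofReal (p ^ (1 / 2 : ℝ)) *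
            (ENNReal.ofReal (p ^ (-(1 / 2) : ℝ)) * eLpNorm z (ENNReal.ofReal p) P) := by
          rw [← mul_assoc, ← ENNReal.ofReal_mul (by positivity), ← Real.rpow_add hp0]
          norm_num
      _ ≤ _ := by
          rw [ENNReal.ofReal_mul (p := p ^ (1 / 2 : ℝ)) (by positivity)]
          exact mul_le_mul_right h1 _
  rw [eLpNorm_eq_lintegral_rpow_enorm_toReal (by simpa using hp0) (by simp),
    ENNReal.toReal_ofReal hp0.le] at h2
  have h3 := ENNReal.rpow_le_rpow h2 hp0.le
  rw [← ENNReal.rpow_mul, one_div_mul_cancel hp0.ne', ENNReal.rpow_one,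
    ENNReal.ofReal_rpow_of_nonneg (by positivity) hp0.le] at h3
  refine le_trans (le_of_eq (lintegral_congr fun ω => ?_)) (h3.trans (le_of_eq ?_))
  · rw [Real.enorm_eq_ofReal_abs, ENNReal.ofReal_rpow_of_nonneg (abs_nonneg _) hp0.le, hp]
    congr 1
    rw [← sq_abs, ← pow_mul, ← Real.rpow_natCast]
    push_cast
    rfl
  · congr 1
    have e : (p ^ (1 / 2 : ℝ)) ^ 2 = p := by
      rw [← Real.rpow_natCast, ← Real.rpow_mul hp0.le]; norm_num
    calc (p ^ (1 / 2 : ℝ) * K) ^ p = (p ^ (1 / 2 : ℝ) * K) ^ (2 * n) := by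
          rw [← Real.rpow_natCast]; push_cast; rfl
      _ = (K ^ 2 * p) ^ n := by rw [pow_mul, mul_pow, e, mul_comm]

/-- The power series of the exponential is summed term by term; the moment bound and
`n ^ n ≤ e ^ n * n !` dominate it by a geometric series. -/
theorem lintegral_exp_sq_le {z : Ω → ℝ} (hz : Measurable z) [IsProbabilityMeasure P] {K c : ℝ}
    (hK : 0 < K) (hc : 0 < c) (hcK : c * K ^ 2 ≤ 1 / 12)
    (h : psi2Norm P z ≤ ENNReal.ofReal K) :
    ∫⁻ ω, ENNReal.ofReal (Real.exp (c * z ω ^ 2)) ∂P ≤ 2 := by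
  have e1 : ∀ ω, ENNReal.ofReal (Real.exp (c * z ω ^ 2))
      = ∑' n : ℕ, ENNReal.ofReal (c ^ n / n.factorial) * ENNReal.ofReal ((z ω ^ 2) ^ n) := by
    intro ω
    rw [Real.exp_eq_exp_ℝ, NormedSpace.exp_eq_tsum_div,
      ENNReal.ofReal_tsum_of_nonneg (fun n => by positivity)
        (Real.summable_pow_div_factorial _)]
    refine tsum_congr fun n => ?_
    rw [← ENNReal.ofReal_mul (by positivity), mul_pow]
    congr 1
    ring
  simp_rw [e1]
  rw [lintegral_tsum (fun n => by fun_prop)]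
  have e2 : (2 : ℝ≥0∞) = ∑' n : ℕ, ENNReal.ofReal ((1 / 2 : ℝ) ^ n) := by
    rw [← ENNReal.ofReal_tsum_of_nonneg (fun n => by positivity) summable_geometric_two,
      tsum_geometric_two]
    norm_num
  rw [e2]
  refine ENNReal.tsum_le_tsum fun n => ?_
  rw [lintegral_const_mul _ (by fun_prop)]
  rcases Nat.eq_zero_or_pos n with rfl | hn
  · simp
  refine le_trans (mul_le_mul_right (lintegral_pow_le_of_psi2Norm_le hK h hn) _) ?_
  rw [← ENNReal.ofReal_mul (by positivity)]
  apply ENNReal.ofReal_le_ofReal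
  have h3 : (n : ℝ) ^ n / n.factorial ≤ 3 ^ n := by
    refine (Real.pow_div_factorial_le_exp (n : ℝ) (Nat.cast_nonneg n) n).trans ?_
    rw [← mul_one (n : ℝ), Real.exp_nat_mul]
    gcongr
    linarith [Real.exp_one_lt_d9]
  calc c ^ n / n.factorial * (K ^ 2 * (2 * n)) ^ n
      = (2 * (c * K ^ 2)) ^ n * ((n : ℝ) ^ n / n.factorial) := by
        simp only [mul_pow]; ring
    _ ≤ (2 * (1 / 12)) ^ n * 3 ^ n := by gcongr
    _ = (1 / 2 : ℝ) ^ n := by rw [← mul_pow]; norm_num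

theorem integrable_exp_of_lintegral_le {f : Ω → ℝ} (hf : Measurable f) {M : ℝ} (hM : 0 ≤ M)
    (h : ∫⁻ ω, ENNReal.ofReal (Real.exp (f ω)) ∂P ≤ ENNReal.ofReal M) :
    Integrable (fun ω => Real.exp (f ω)) P ∧ ∫ ω, Real.exp (f ω) ∂P ≤ M := by
  refine ⟨⟨by fun_prop, ?_⟩, ?_⟩
  · rw [hasFiniteIntegral_iff_ofReal (Filter.Eventually.of_forall fun ω => (Real.exp_pos _).le)]
    exact h.trans_lt ENNReal.ofReal_lt_top
  · rw [integral_eq_lintegral_of_nonneg_ae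
      (Filter.Eventually.of_forall fun ω => (Real.exp_pos _).le) (by fun_prop)]
    exact ENNReal.toReal_le_of_le_ofReal hM h

/-- Exponential square moment of the marginals of a sub-Gaussian vector in directions of the
unit ball. -/
theorem integrable_exp_inner_sq {n : ℕ} {Y : Ω → EuclideanSpace ℝ (Fin n)} (hY : Measurable Y)
    [IsProbabilityMeasure P] {K c : ℝ} (hK : 0 < K) (hc : 0 < c) (hcK : c * K ^ 2 ≤ 1 / 12)
    (h : psi2NormVec P Y ≤ ENNReal.ofReal K) {u : EuclideanSpace ℝ (Fin n)} (hu : ‖u‖ ≤ 1) :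
    Integrable (fun ω => Real.exp (c * inner ℝ (Y ω) u ^ 2)) P ∧
      ∫ ω, Real.exp (c * inner ℝ (Y ω) u ^ 2) ∂P ≤ 2 := by
  have hm : ∀ v, Measurable fun ω => inner ℝ (Y ω) v := fun v => hY.inner measurable_const
  have hmu := hm u
  refine integrable_exp_of_lintegral_le (by fun_prop) (by norm_num) ?_
  rw [ENNReal.ofReal_ofNat]
  rcases eq_or_ne u 0 with rfl | hu0
  · simp
  set v := (‖u‖)⁻¹ • u with hv
  have hv1 : v ∈ Metric.sphere (0 : EuclideanSpace ℝ (Fin n)) 1 := by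
    simp [hv, norm_smul, hu0]
  have h1 : psi2Norm P (fun ω => inner ℝ (Y ω) v) ≤ ENNReal.ofReal K :=
    le_trans (le_iSup₂ (f := fun (z : EuclideanSpace ℝ (Fin n))
      (_ : z ∈ Metric.sphere (0 : EuclideanSpace ℝ (Fin n)) 1) =>
        psi2Norm P (fun ω => inner ℝ (Y ω) z)) v hv1) h
  refine le_trans (lintegral_mono fun ω => ?_) (lintegral_exp_sq_le (hm v) hK hc hcK h1)
  apply ENNReal.ofReal_le_ofReal
  apply Real.exp_le_exp.2
  have hu' : u = ‖u‖ • v := by rw [hv, smul_inv_smul₀ (norm_ne_zero_iff.2 hu0)]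
  have h2 : inner ℝ (Y ω) u = ‖u‖ * inner ℝ (Y ω) v := by
    conv_lhs => rw [hu', inner_smul_right]
  rw [h2, mul_pow]
  gcongr
  exact mul_le_of_le_one_left (sq_nonneg _) (pow_le_one₀ (norm_nonneg _) hu)

/-- For a centered variable the linear term of a bound on the exponential integrates to zero. -/
theorem mgf_le_one_add_integral [IsProbabilityMeasure P] {Y W : Ω → ℝ} (hY : Measurable Y)
    (h0 : Integrable Y P) (hc : ∫ ω, Y ω ∂P = 0) (hW : Integrable W P) {θ : ℝ}
    (key : ∀ ω, Real.exp (θ * Y ω) ≤ 1 + θ * Y ω + W ω) :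
    Integrable (fun ω => Real.exp (θ * Y ω)) P ∧ mgf Y P θ ≤ 1 + ∫ ω, W ω ∂P := by
  have hlin : Integrable (fun ω => 1 + θ * Y ω) P := (integrable_const 1).add (h0.const_mul θ)
  have hint : Integrable (fun ω => 1 + θ * Y ω + W ω) P := hlin.add hW
  have hI : Integrable (fun ω => Real.exp (θ * Y ω)) P := by
    refine hint.mono' (by fun_prop) (Filter.Eventually.of_forall fun ω => ?_)
    rw [Real.norm_eq_abs, Real.abs_exp]
    exact key ω
  refine ⟨hI, ?_⟩
  calc mgf Y P θ ≤ ∫ ω, (1 + θ * Y ω + W ω) ∂P := integral_mono hI hint key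
    _ = 1 + ∫ ω, W ω ∂P := by
        rw [integral_add hlin hW, integral_add (integrable_const 1) (h0.const_mul θ),
          integral_const_mul, hc]
        simp

/-- A centered variable with an exponential square moment has a sub-Gaussian moment generating
function on the whole line. -/
theorem mgf_le_of_integral_exp_sq_le [IsProbabilityMeasure P] {Y : Ω → ℝ} (hY : Measurable Y)
    (h0 : Integrable Y P) (hc : ∫ ω, Y ω ∂P = 0) {b M : ℝ} (hb : 0 < b)
    (hi : Integrable (fun ω => Real.exp (2 * b * Y ω ^ 2)) P)
    (hM : ∫ ω, Real.exp (2 * b * Y ω ^ 2) ∂P ≤ M) (θ : ℝ) :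
    Integrable (fun ω => Real.exp (θ * Y ω)) P ∧
      mgf Y P θ ≤ Real.exp ((M + 1 / 4) * θ ^ 2 / b) := by
  set G := θ ^ 2 / b * Real.exp (θ ^ 2 / (4 * b)) with hG
  have key : ∀ ω, Real.exp (θ * Y ω) ≤ 1 + θ * Y ω + G * Real.exp (2 * b * Y ω ^ 2) := by
    intro ω
    have h1 := exp_le_one_add_add_sq_mul_exp_abs (θ * Y ω)
    have h2 : |θ * Y ω| ≤ θ ^ 2 / (4 * b) + b * Y ω ^ 2 := by
      have e : θ ^ 2 / (4 * b) + b * Y ω ^ 2 - |θ * Y ω| = b * (|θ| / (2 * b) - |Y ω|) ^ 2 := by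
        rw [abs_mul, ← sq_abs θ, ← sq_abs (Y ω)]
        field_simp
        ring
      have : 0 ≤ b * (|θ| / (2 * b) - |Y ω|) ^ 2 := by positivity
      linarith
    have h3 : Y ω ^ 2 ≤ Real.exp (b * Y ω ^ 2) / b := by
      rw [le_div_iff₀ hb]
      linarith [Real.add_one_le_exp (b * Y ω ^ 2)]
    have h4 : (θ * Y ω) ^ 2 * Real.exp |θ * Y ω| ≤ G * Real.exp (2 * b * Y ω ^ 2) := by
      calc (θ * Y ω) ^ 2 * Real.exp |θ * Y ω|
          ≤ (θ ^ 2 * (Real.exp (b * Y ω ^ 2) / b)) *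
              Real.exp (θ ^ 2 / (4 * b) + b * Y ω ^ 2) := by
            rw [mul_pow]
            gcongr
        _ = G * Real.exp (2 * b * Y ω ^ 2) := by
            rw [hG, Real.exp_add, show 2 * b * Y ω ^ 2 = b * Y ω ^ 2 + b * Y ω ^ 2 by ring,
              Real.exp_add]
            ring
    linarith
  obtain ⟨hI, hmgf⟩ := mgf_le_one_add_integral hY h0 hc (hi.const_mul G) key
  refine ⟨hI, ?_⟩
  have h5 : mgf Y P θ ≤ 1 + G * M := by
    rw [integral_const_mul] at hmgf
    refine hmgf.trans ?_
    gcongr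
  have hM0 : 0 ≤ M := le_trans (integral_nonneg fun ω => (Real.exp_pos _).le) hM
  have hs : 0 ≤ θ ^ 2 / b := by positivity
  have e1 : Real.exp (θ ^ 2 / (4 * b)) = Real.exp (1 / 4 * (θ ^ 2 / b)) := by
    congr 1; field_simp
  have e2 : (M + 1 / 4) * θ ^ 2 / b = M * (θ ^ 2 / b) + 1 / 4 * (θ ^ 2 / b) := by ring
  rw [e2, Real.exp_add]
  rw [hG, e1] at h5
  have h6 := Real.add_one_le_exp (M * (θ ^ 2 / b))
  have h7 : 1 ≤ Real.exp (1 / 4 * (θ ^ 2 / b)) := Real.one_le_exp (by positivity)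
  nlinarith

/-- A centered variable with an exponential moment has, near the origin, a moment generating
function of sub-Gaussian size. -/
theorem mgf_le_of_integral_exp_abs_le [IsProbabilityMeasure P] {X : Ω → ℝ} (hX : Measurable X)
    (h0 : Integrable X P) (hc : ∫ ω, X ω ∂P = 0) {b M : ℝ} (hb : 0 < b)
    (hi : Integrable (fun ω => Real.exp (2 * b * |X ω|)) P)
    (hM : ∫ ω, Real.exp (2 * b * |X ω|) ∂P ≤ M) {θ : ℝ} (hθ : |θ| ≤ b) :
    Integrable (fun ω => Real.exp (θ * X ω)) P ∧
      mgf X P θ ≤ Real.exp (2 * M * θ ^ 2 / b ^ 2) := by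
  set G := 2 * θ ^ 2 / b ^ 2 with hG
  have key : ∀ ω, Real.exp (θ * X ω) ≤ 1 + θ * X ω + G * Real.exp (2 * b * |X ω|) := by
    intro ω
    have h1 := exp_le_one_add_add_sq_mul_exp_abs (θ * X ω)
    have h2 : |θ * X ω| ≤ b * |X ω| := by
      rw [abs_mul]; gcongr
    have h3 : X ω ^ 2 ≤ 2 * Real.exp (b * |X ω|) / b ^ 2 := by
      rw [le_div_iff₀ (by positivity)]
      have := Real.quadratic_le_exp_of_nonneg (x := b * |X ω|) (by positivity)
      have h' : 0 ≤ b * |X ω| := by positivity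
      rw [← sq_abs]
      nlinarith
    have h4 : (θ * X ω) ^ 2 * Real.exp |θ * X ω| ≤ G * Real.exp (2 * b * |X ω|) := by
      calc (θ * X ω) ^ 2 * Real.exp |θ * X ω|
          ≤ (θ ^ 2 * (2 * Real.exp (b * |X ω|) / b ^ 2)) * Real.exp (b * |X ω|) := by
            rw [mul_pow]
            gcongr
        _ = G * Real.exp (2 * b * |X ω|) := by
            rw [hG, show 2 * b * |X ω| = b * |X ω| + b * |X ω| by ring, Real.exp_add]
            ring
    linarith
  obtain ⟨hI, hmgf⟩ := mgf_le_one_add_integral hX h0 hc (hi.const_mul G) key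
  refine ⟨hI, ?_⟩
  rw [integral_const_mul] at hmgf
  calc mgf X P θ ≤ 1 + G * ∫ ω, Real.exp (2 * b * |X ω|) ∂P := hmgf
    _ ≤ G * M + 1 := by
        rw [add_comm]
        gcongr
    _ ≤ Real.exp (G * M) := Real.add_one_le_exp _
    _ = _ := by rw [hG]; congr 1; ring

/-- Chernoff bound for a sum of independent variables. -/
theorem measure_le_sum_le_exp {m : ℕ} [IsProbabilityMeasure P] {Z : Fin m → Ω → ℝ}
    (hind : iIndepFun Z P) (hmeas : ∀ j, Measurable (Z j)) {θ v : ℝ} (hθ : 0 ≤ θ)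
    (hint : ∀ j, Integrable (fun ω => Real.exp (θ * Z j ω)) P)
    (hmgf : ∀ j, mgf (Z j) P θ ≤ Real.exp v) (s : ℝ) :
    P.real {ω | s ≤ ∑ j, Z j ω} ≤ Real.exp (m * v - θ * s) := by
  have h1 := measure_ge_le_exp_mul_mgf (μ := P) (X := ∑ j, Z j) s hθ
    (hind.integrable_exp_mul_sum hmeas fun j _ => hint j)
  rw [hind.mgf_sum hmeas] at h1
  simp only [Finset.sum_apply] at h1
  refine h1.trans ?_
  calc Real.exp (-θ * s) * ∏ j, mgf (Z j) P θ
      ≤ Real.exp (-θ * s) * ∏ _j : Fin m, Real.exp v := by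
        gcongr with j _
        · exact fun j _ => mgf_nonneg
        · exact hmgf j
    _ = Real.exp (m * v - θ * s) := by
        rw [Finset.prod_const, Finset.card_univ, Fintype.card_fin, ← Real.exp_nat_mul,
          ← Real.exp_add]
        congr 1; ring

/-- Two-sided form of `measure_le_sum_le_exp`. -/
theorem measure_le_abs_sum_le_exp {m : ℕ} [IsProbabilityMeasure P] {Z : Fin m → Ω → ℝ}
    (hind : iIndepFun Z P) (hmeas : ∀ j, Measurable (Z j)) {θ v : ℝ} (hθ : 0 ≤ θ)
    (hint : ∀ t, |t| ≤ θ → ∀ j, Integrable (fun ω => Real.exp (t * Z j ω)) P)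
    (hmgf : ∀ t, |t| = θ → ∀ j, mgf (Z j) P t ≤ Real.exp v) (s : ℝ) :
    P.real {ω | s ≤ |∑ j, Z j ω|} ≤ 2 * Real.exp (m * v - θ * s) := by
  have h1 := measure_le_sum_le_exp hind hmeas hθ (hint θ (abs_of_nonneg hθ).le)
    (hmgf θ (abs_of_nonneg hθ)) s
  have habs : |(-θ)| = θ := by rw [abs_neg, abs_of_nonneg hθ]
  have h2 := measure_le_sum_le_exp (Z := fun j ω => - Z j ω)
    (hind.comp (fun _ x => -x) (fun _ => measurable_neg)) (fun j => (hmeas j).neg) hθ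
    (fun j => by simpa using hint (-θ) habs.le j)
    (fun j => by
      have := hmgf (-θ) habs j
      rw [← mgf_neg] at this
      exact this) s
  have hsub : {ω | s ≤ |∑ j, Z j ω|} ⊆ {ω | s ≤ ∑ j, Z j ω} ∪ {ω | s ≤ ∑ j, - Z j ω} := by
    intro ω hω
    simp only [Set.mem_union, Set.mem_ofPred_eq, Finset.sum_neg_distrib]
    exact le_abs.1 hω
  linarith [(measureReal_mono hsub).trans (measureReal_union_le (μ := P) _ _)]

end Moments

/-! ### Nets in the unit ball -/

section Net

variable {F : Type*} [NormedAddCommGroup F] [InnerProductSpace ℝ F]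

/-- A `1 / 2`-net of the unit ball of controlled size: half of a largest `1`-separated set in the
ball of radius `2`. -/
theorem exists_net [FiniteDimensional ℝ F] :
    ∃ N : Finset F, N.card ≤ 5 ^ Module.finrank ℝ F ∧ (∀ u ∈ N, ‖u‖ ≤ 1) ∧
      ∀ x : F, ‖x‖ ≤ 1 → ∃ u ∈ N, ‖x - u‖ ≤ 1 / 2 := by
  classical
  let S : ℕ → Prop := fun n => ∃ s : Finset F, s.card = n ∧ (∀ c ∈ s, ‖c‖ ≤ 2) ∧
    ∀ c ∈ s, ∀ d ∈ s, c ≠ d → 1 ≤ ‖c - d‖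
  have hbd : ∀ n, S n → n ≤ 5 ^ Module.finrank ℝ F := by
    rintro n ⟨s, rfl, h1, h2⟩
    exact Besicovitch.card_le_of_separated s h1 h2
  have h0 : S 0 := ⟨∅, by simp⟩
  obtain ⟨s, hcard, hs, hsep⟩ : S (Nat.findGreatest S (5 ^ Module.finrank ℝ F)) :=
    Nat.findGreatest_spec (Nat.zero_le _) h0
  have hmax : ∀ x : F, ‖x‖ ≤ 2 → ∃ c ∈ s, ‖x - c‖ < 1 := by
    intro x hx
    by_contra! hfar
    have hxs : x ∉ s := fun h => absurd (hfar x h) (by simp)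
    have hS : S (s.card + 1) := by
      refine ⟨insert x s, Finset.card_insert_of_notMem hxs, ?_, ?_⟩
      · intro c hc
        rcases Finset.mem_insert.1 hc with rfl | hc
        exacts [hx, hs c hc]
      · intro c hc d hd hcd
        rcases Finset.mem_insert.1 hc with hc' | hc' <;>
          rcases Finset.mem_insert.1 hd with hd' | hd'
        · exact absurd (hc'.trans hd'.symm) hcd
        · rw [hc']; exact hfar d hd'
        · rw [hd', norm_sub_rev]; exact hfar c hc'
        · exact hsep c hc' d hd' hcd
    have := Nat.le_findGreatest (hbd _ hS) hS
    omega
  refine ⟨s.image fun c => (1 / 2 : ℝ) • c, ?_, ?_, ?_⟩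
  · exact Finset.card_image_le.trans (hcard ▸ Nat.findGreatest_le _)
  · intro u hu
    obtain ⟨c, hc, rfl⟩ := Finset.mem_image.1 hu
    rw [norm_smul]
    norm_num
    linarith [hs c hc]
  · intro x hx
    obtain ⟨c, hc, hxc⟩ := hmax ((2 : ℝ) • x) (by rw [norm_smul]; norm_num; linarith)
    refine ⟨_, Finset.mem_image_of_mem _ hc, ?_⟩
    have e : x - (1 / 2 : ℝ) • c = (1 / 2 : ℝ) • ((2 : ℝ) • x - c) := by
      rw [smul_sub, smul_smul]; norm_num
    rw [e, norm_smul]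
    norm_num
    linarith

/-- The operator norm is controlled by the bilinear form on a `1 / 2`-net: both approximating the
argument and testing the value against the net cost a factor `2`. -/
theorem opNorm_le_of_net {N : Finset F} (hN : ∀ x : F, ‖x‖ ≤ 1 → ∃ u ∈ N, ‖x - u‖ ≤ 1 / 2)
    (T : F →L[ℝ] F) {s : ℝ} (hs : 0 ≤ s)
    (h : ∀ u ∈ N, ∀ y ∈ N, |inner ℝ (T u) y| ≤ s) : ‖T‖ ≤ 4 * s := by
  have h1 : ∀ u ∈ N, ‖T u‖ ≤ 2 * s := by
    intro u hu
    rcases eq_or_ne (T u) 0 with h0 | h0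
    · rw [h0, norm_zero]; positivity
    set e := (‖T u‖)⁻¹ • T u with he
    have he1 : ‖e‖ = 1 := by rw [he, norm_smul, norm_inv, norm_norm, inv_mul_cancel₀ (by simpa)]
    obtain ⟨y, hy, hey⟩ := hN e he1.le
    have h2 : inner ℝ (T u) e = ‖T u‖ := by
      rw [he, inner_smul_right, real_inner_self_eq_norm_sq]
      field_simp
    have h3 : inner ℝ (T u) (e - y) ≤ ‖T u‖ * (1 / 2) :=
      (real_inner_le_norm _ _).trans (by gcongr)
    rw [inner_sub_right, h2] at h3
    linarith [(le_abs_self _).trans (h u hu y hy)]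
  have h2 : ‖T‖ ≤ 2 * s + ‖T‖ / 2 := by
    refine T.opNorm_le_of_unit_norm (by positivity) fun x hx => ?_
    obtain ⟨u, hu, hxu⟩ := hN x hx.le
    calc ‖T x‖ = ‖T u + T (x - u)‖ := by rw [← map_add]; simp
      _ ≤ ‖T u‖ + ‖T (x - u)‖ := norm_add_le _ _
      _ ≤ 2 * s + ‖T‖ * (1 / 2) := by
          gcongr
          · exact h1 u hu
          · exact (T.le_opNorm _).trans (by gcongr)
      _ = _ := by ring
  linarith

end Net

/-! ### Deterministic error bounds -/

section Deterministic

variable {m k : ℕ}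

/-- The deviation `(1 / m) EᵀE - 1` of the sample covariance matrix of the rows from the identity,
as an operator on Euclidean space. -/
noncomputable def covDev (E : Matrix (Fin m) (Fin k) ℝ) :
    EuclideanSpace ℝ (Fin k) →L[ℝ] EuclideanSpace ℝ (Fin k) :=
  Matrix.toEuclideanCLM (𝕜 := ℝ) ((m : ℝ)⁻¹ • (Eᵀ * E) - 1)

theorem toLp_gram_mulVec (hm : 0 < m) (E : Matrix (Fin m) (Fin k) ℝ) (r : Fin k → ℝ) :
    WithLp.toLp 2 ((Eᵀ * E) *ᵥ r) = (m : ℝ) • (WithLp.toLp 2 r + covDev E (WithLp.toLp 2 r)) := by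
  have hm' : (m : ℝ) ≠ 0 := by positivity
  rw [covDev, Matrix.toEuclideanCLM_toLp, ← WithLp.toLp_add, ← WithLp.toLp_smul,
    Matrix.sub_mulVec, Matrix.one_mulVec, Matrix.smul_mulVec, add_sub_cancel,
    smul_inv_smul₀ hm']

theorem inner_covDev (hm : 0 < m) (E : Matrix (Fin m) (Fin k) ℝ)
    (u y : EuclideanSpace ℝ (Fin k)) :
    (m : ℝ) * inner ℝ (covDev E u) y =
      ∑ j, (inner ℝ (WithLp.toLp 2 (E j)) u * inner ℝ (WithLp.toLp 2 (E j)) y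
        - inner ℝ u y) := by
  have h := toLp_gram_mulVec hm E u.ofLp
  have h2 : inner ℝ (WithLp.toLp 2 ((Eᵀ * E) *ᵥ u.ofLp)) y
      = ∑ j, inner ℝ (WithLp.toLp 2 (E j)) u * inner ℝ (WithLp.toLp 2 (E j)) y := by
    have hrow : ∀ (j : Fin m) (v : EuclideanSpace ℝ (Fin k)),
        inner ℝ (WithLp.toLp 2 (E j)) v = (E *ᵥ v.ofLp) j := by
      intro j v
      simp [EuclideanSpace.inner_eq_star_dotProduct, Matrix.mulVec, dotProduct_comm]
    simp_rw [hrow]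
    rw [EuclideanSpace.inner_eq_star_dotProduct, ← Matrix.mulVec_mulVec]
    simp only [star_trivial]
    rw [Matrix.dotProduct_mulVec, Matrix.vecMul_transpose]
    simp [dotProduct, mul_comm]
  rw [Finset.sum_sub_distrib, ← h2, h]
  simp only [WithLp.toLp_ofLp, inner_smul_left, inner_add_left, Finset.sum_const,
    Finset.card_univ, Fintype.card_fin, nsmul_eq_mul]
  simp
  ring

/-- The vector `Eᵀ (E x - Q (E x))` that the normal equations map to the reconstruction error. -/
noncomputable def backproj (δ : ℝ) (E : Matrix (Fin m) (Fin k) ℝ) (x : Fin k → ℝ) :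
    EuclideanSpace ℝ (Fin k) :=
  WithLp.toLp 2 (Eᵀ *ᵥ (E *ᵥ x - quantize δ (E *ᵥ x)))

/-- The normal equations for the reconstruction error. -/
theorem gram_mulVec_error (δ : ℝ) (E : Matrix (Fin m) (Fin k) ℝ) (h : E.rank = k)
    (x : Fin k → ℝ) :
    (Eᵀ * E) *ᵥ (x - pinv E *ᵥ quantize δ (E *ᵥ x))
      = Eᵀ *ᵥ (E *ᵥ x - quantize δ (E *ᵥ x)) := by
  have h1 := pinv_mul_self E h
  have hu : IsUnit (Eᵀ * E) := by
    rw [pinv, Matrix.mul_assoc] at h1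
    exact (Matrix.isUnit_iff_isUnit_det _).2 (Matrix.isUnit_det_of_left_inverse h1)
  have h2 : (Eᵀ * E) * pinv E = Eᵀ := by
    rw [pinv, ← Matrix.mul_assoc, Matrix.mul_nonsing_inv _ ((Matrix.isUnit_iff_isUnit_det _).1 hu),
      Matrix.one_mul]
  rw [Matrix.mulVec_sub, Matrix.mulVec_sub, Matrix.mulVec_mulVec, h2, Matrix.mulVec_mulVec]

theorem norm_backproj_le (hm : 0 < m) {δ t : ℝ} {E : Matrix (Fin m) (Fin k) ℝ} (h : E.rank = k)
    (hE : ‖covDev E‖ ≤ t) (x : Fin k → ℝ) :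
    ‖backproj δ E x‖ ≤ m * (1 + t) * reconError δ E x := by
  rw [backproj, ← gram_mulVec_error δ E h, toLp_gram_mulVec hm, norm_smul, Real.norm_natCast,
    mul_assoc]
  gcongr
  refine (norm_add_le _ _).trans ?_
  rw [add_mul, one_mul]
  gcongr
  · exact le_rfl
  · exact (covDev E).le_of_opNorm_le hE _

theorem le_norm_backproj (hm : 0 < m) {δ t : ℝ} {E : Matrix (Fin m) (Fin k) ℝ} (h : E.rank = k)
    (hE : ‖covDev E‖ ≤ t) (x : Fin k → ℝ) :
    m * (1 - t) * reconError δ E x ≤ ‖backproj δ E x‖ := by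
  rw [backproj, ← gram_mulVec_error δ E h, toLp_gram_mulVec hm, norm_smul, Real.norm_natCast,
    mul_assoc]
  gcongr
  rw [sub_mul, one_mul]
  have h1 := (covDev E).le_of_opNorm_le hE
    (WithLp.toLp 2 (x - pinv E *ᵥ quantize δ (E *ᵥ x)))
  have h2 := norm_sub_norm_le (WithLp.toLp 2 (x - pinv E *ᵥ quantize δ (E *ᵥ x)))
    (-(covDev E (WithLp.toLp 2 (x - pinv E *ᵥ quantize δ (E *ᵥ x)))))
  rw [norm_neg, sub_neg_eq_add] at h2
  refine le_trans ?_ h2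
  exact sub_le_sub le_rfl h1

theorem rank_eq_of_norm_covDev_lt_one (hm : 0 < m) {E : Matrix (Fin m) (Fin k) ℝ}
    (hE : ‖covDev E‖ < 1) : E.rank = k := by
  have hinj : Function.Injective (Eᵀ * E).mulVecLin := by
    rw [← LinearMap.ker_eq_bot, LinearMap.ker_eq_bot']
    intro v hv
    rw [Matrix.mulVecLin_apply] at hv
    have h1 := toLp_gram_mulVec hm E v
    rw [hv, WithLp.toLp_zero] at h1
    have hm' : (m : ℝ) ≠ 0 := by positivity
    have h2 := eq_neg_of_add_eq_zero_left ((smul_eq_zero.1 h1.symm).resolve_left hm')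
    have h3 := (covDev E).le_opNorm (WithLp.toLp 2 v)
    rw [← norm_neg, ← h2] at h3
    have h4 : ‖WithLp.toLp 2 v‖ = 0 := by
      by_contra hne
      have : 0 < ‖WithLp.toLp 2 v‖ := lt_of_le_of_ne (norm_nonneg _) (Ne.symm hne)
      nlinarith
    simpa using h4
  rw [← Matrix.rank_transpose_mul_self, Matrix.rank, LinearMap.finrank_range_of_inj hinj]
  simp

end Deterministic

/-! ### Concentration of the back-projected quantization error -/

theorem abs_sub_scalarQuantizer_le {δ : ℝ} (hδ : 0 < δ) (t : ℝ) :
    |t - scalarQuantizer δ t| ≤ δ / 2 := by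
  have h := (scalarQuantizer_eq_iff hδ t ⌈t / δ - 1 / 2⌉).1 rfl
  have e : scalarQuantizer δ t = (⌈t / δ - 1 / 2⌉ : ℤ) * δ := rfl
  rw [← e, Set.mem_Ioc] at h
  rw [abs_le]
  constructor <;> linarith [h.1, h.2]

theorem measurable_scalarQuantizer (δ : ℝ) : Measurable (scalarQuantizer δ) := by
  unfold scalarQuantizer
  fun_prop

/-- The contribution of one row `y` to the `i`-th coordinate of `Eᵀ (E x - Q (E x))`. -/
noncomputable def rowTerm {k : ℕ} (δ : ℝ) (x : Fin k → ℝ) (i : Fin k)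
    (y : EuclideanSpace ℝ (Fin k)) : ℝ :=
  y i * ((y.ofLp ⬝ᵥ x) - scalarQuantizer δ (y.ofLp ⬝ᵥ x))

theorem measurable_rowTerm {k : ℕ} (δ : ℝ) (x : Fin k → ℝ) (i : Fin k) :
    Measurable (rowTerm δ x i) := by
  have h1 : Measurable fun y : EuclideanSpace ℝ (Fin k) => y.ofLp ⬝ᵥ x := by
    unfold dotProduct; fun_prop
  have h2 := (measurable_scalarQuantizer δ).comp h1
  unfold rowTerm
  exact (by fun_prop : Measurable fun y : EuclideanSpace ℝ (Fin k) => y i).mul (h1.sub h2)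

theorem backproj_apply {Ω : Type*} {m k : ℕ} {E : Ω → Matrix (Fin m) (Fin k) ℝ} (δ : ℝ)
    (x : Fin k → ℝ) (i : Fin k) (ω : Ω) :
    backproj δ (E ω) x i = ∑ j, rowTerm δ x i (row E j ω) := rfl

section Random

variable {Ω : Type*} [MeasurableSpace Ω] {P : Measure Ω}

theorem integrable_sq_of_integrable_exp_sq {Y : Ω → ℝ} (hY : Measurable Y) {c : ℝ} (hc : 0 < c)
    (h : Integrable (fun ω => Real.exp (c * Y ω ^ 2)) P) : Integrable (fun ω => Y ω ^ 2) P := by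
  refine (h.const_mul c⁻¹).mono' (by fun_prop) (Filter.Eventually.of_forall fun ω => ?_)
  rw [Real.norm_eq_abs, abs_of_nonneg (sq_nonneg _), inv_mul_eq_div, le_div_iff₀ hc]
  linarith [Real.add_one_le_exp (c * Y ω ^ 2)]

theorem integrable_of_integrable_sq [IsProbabilityMeasure P] {Y : Ω → ℝ} (hY : Measurable Y)
    (h : Integrable (fun ω => Y ω ^ 2) P) : Integrable Y P := by
  refine ((integrable_const (1 : ℝ)).add h).mono' (by fun_prop)
    (Filter.Eventually.of_forall fun ω => ?_)
  simp only [Pi.add_apply, Real.norm_eq_abs]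
  nlinarith [sq_abs (Y ω), sq_nonneg (|Y ω| - 1)]

/-- Centering preserves the exponential square moment up to constants, because the squared mean
is at most the mean square. -/
theorem mgf_sub_integral_le [IsProbabilityMeasure P] {Y : Ω → ℝ} (hY : Measurable Y) {β : ℝ}
    (hβ : 0 < β) (hi : Integrable (fun ω => Real.exp (β * Y ω ^ 2)) P)
    (hM : ∫ ω, Real.exp (β * Y ω ^ 2) ∂P ≤ 2) (θ : ℝ) :
    Integrable (fun ω => Real.exp (θ * (Y ω - ∫ ω', Y ω' ∂P))) P ∧
      mgf (fun ω => Y ω - ∫ ω', Y ω' ∂P) P θ ≤ Real.exp (25 * θ ^ 2 / β) := by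
  have hsq := integrable_sq_of_integrable_exp_sq hY hβ hi
  have hY1 := integrable_of_integrable_sq hY hsq
  set a := ∫ ω', Y ω' ∂P with ha
  have h1 : β * ∫ ω, Y ω ^ 2 ∂P ≤ 1 := by
    have : ∫ ω, (β * Y ω ^ 2 + 1) ∂P ≤ ∫ ω, Real.exp (β * Y ω ^ 2) ∂P :=
      integral_mono ((hsq.const_mul β).add (integrable_const 1)) hi
        fun ω => Real.add_one_le_exp _
    rw [integral_add (hsq.const_mul β) (integrable_const 1), integral_const_mul] at this
    simp at this
    linarith
  have h2 : a ^ 2 ≤ ∫ ω, Y ω ^ 2 ∂P := by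
    have : 0 ≤ ∫ ω, (Y ω ^ 2 - 2 * a * Y ω + a ^ 2) ∂P :=
      integral_nonneg fun ω => by
        have := sq_nonneg (Y ω - a)
        simp only [Pi.zero_apply]
        nlinarith
    have hs : Integrable (fun ω => Y ω ^ 2 - 2 * a * Y ω) P := hsq.sub (hY1.const_mul _)
    rw [integral_add hs (integrable_const _), integral_sub hsq (hY1.const_mul _),
      integral_const_mul, ← ha] at this
    simp at this
    nlinarith
  have h3 : β * a ^ 2 ≤ 1 := le_trans (by gcongr) h1
  have hle : ∀ ω, Real.exp (2 * (β / 4) * (Y ω - a) ^ 2)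
      ≤ Real.exp 1 * Real.exp (β * Y ω ^ 2) := by
    intro ω
    rw [← Real.exp_add]
    apply Real.exp_le_exp.2
    nlinarith [mul_nonneg hβ.le (sq_nonneg (Y ω + a))]
  have hi' : Integrable (fun ω => Real.exp (2 * (β / 4) * (Y ω - a) ^ 2)) P := by
    refine (hi.const_mul (Real.exp 1)).mono' (by fun_prop) (Filter.Eventually.of_forall fun ω => ?_)
    rw [Real.norm_eq_abs, Real.abs_exp]
    exact hle ω
  have hM' : ∫ ω, Real.exp (2 * (β / 4) * (Y ω - a) ^ 2) ∂P ≤ 6 := by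
    refine (integral_mono hi' (hi.const_mul _) hle).trans ?_
    rw [integral_const_mul]
    have := Real.exp_one_lt_d9
    calc Real.exp 1 * ∫ ω, Real.exp (β * Y ω ^ 2) ∂P ≤ 3 * 2 := by
          gcongr
          linarith
      _ = 6 := by norm_num
  have := mgf_le_of_integral_exp_sq_le (P := P) (Y := fun ω => Y ω - a) (by fun_prop)
    (hY1.sub (integrable_const _)) (by rw [integral_sub hY1 (integrable_const _)]; simp [ha])
    (by positivity : 0 < β / 4) hi' hM' θ
  refine ⟨this.1, this.2.trans (le_of_eq ?_)⟩
  congr 1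
  field_simp
  ring

variable {m k : ℕ} {E : Ω → Matrix (Fin m) (Fin k) ℝ} {K : ℝ}

theorem integrable_exp_rowTerm_sq [IsProbabilityMeasure P] (hK : 0 < K)
    (hE : IsSubGaussianFrame P E K) {δ : ℝ} (hδ : 0 < δ) (x : Fin k → ℝ) (i : Fin k) (j : Fin m) :
    Integrable (fun ω => Real.exp (1 / (3 * K ^ 2 * δ ^ 2) * rowTerm δ x i (row E j ω) ^ 2)) P ∧
      ∫ ω, Real.exp (1 / (3 * K ^ 2 * δ ^ 2) * rowTerm δ x i (row E j ω) ^ 2) ∂P ≤ 2 := by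
  have h := integrable_exp_inner_sq (P := P) (hE.measurable_row j) (c := 1 / (12 * K ^ 2)) hK
    (by positivity) (le_of_eq (by field_simp)) (hE.psi2_le j)
    (u := EuclideanSpace.single i 1) (by simp)
  have hle : ∀ ω, Real.exp (1 / (3 * K ^ 2 * δ ^ 2) * rowTerm δ x i (row E j ω) ^ 2)
      ≤ Real.exp (1 / (12 * K ^ 2) * inner ℝ (row E j ω) (EuclideanSpace.single i 1) ^ 2) := by
    intro ω
    apply Real.exp_le_exp.2
    have h1 : inner ℝ (row E j ω) (EuclideanSpace.single i (1 : ℝ)) = row E j ω i := by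
      simp [EuclideanSpace.inner_single_right]
    have h2 := abs_sub_scalarQuantizer_le hδ ((row E j ω).ofLp ⬝ᵥ x)
    rw [h1, rowTerm, mul_pow]
    have h3 : ((row E j ω).ofLp ⬝ᵥ x - scalarQuantizer δ ((row E j ω).ofLp ⬝ᵥ x)) ^ 2
        ≤ (δ / 2) ^ 2 := by
      rw [← sq_abs]; gcongr
    calc _ ≤ 1 / (3 * K ^ 2 * δ ^ 2) * (row E j ω i ^ 2 * (δ / 2) ^ 2) := by gcongr
      _ = _ := by field_simp; ring
  have hm := (measurable_rowTerm δ x i).comp (hE.measurable_row j)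
  have hi : Integrable
      (fun ω => Real.exp (1 / (3 * K ^ 2 * δ ^ 2) * rowTerm δ x i (row E j ω) ^ 2)) P := by
    refine h.1.mono' ?_ (Filter.Eventually.of_forall fun ω => ?_)
    · exact (((hm.pow_const 2).const_mul _).exp).aestronglyMeasurable
    · rw [Real.norm_eq_abs, Real.abs_exp]
      exact hle ω
  exact ⟨hi, (integral_mono hi h.1 hle).trans h.2⟩

theorem integrable_rowTerm [IsProbabilityMeasure P] (hK : 0 < K)
    (hE : IsSubGaussianFrame P E K) {δ : ℝ} (hδ : 0 < δ) (x : Fin k → ℝ) (i : Fin k) (j : Fin m) :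
    Integrable (fun ω => rowTerm δ x i (row E j ω)) P := by
  have hm : Measurable fun ω => rowTerm δ x i (row E j ω) :=
    (measurable_rowTerm δ x i).comp (hE.measurable_row j)
  exact integrable_of_integrable_sq hm (integrable_sq_of_integrable_exp_sq hm
    (c := 1 / (3 * K ^ 2 * δ ^ 2)) (by positivity) (integrable_exp_rowTerm_sq hK hE hδ x i j).1)

theorem integral_backproj_apply [IsProbabilityMeasure P] (hK : 0 < K)
    (hE : IsSubGaussianFrame P E K) {δ : ℝ} (hδ : 0 < δ) (x : Fin k → ℝ) (i : Fin k) :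
    (∫ ω, backproj δ (E ω) x ∂P) i = ∑ j, ∫ ω, rowTerm δ x i (row E j ω) ∂P := by
  rw [eval_integral_piLp (fun i => ?_)]
  · simp_rw [backproj_apply]
    exact integral_finsetSum _ fun j _ => integrable_rowTerm hK hE hδ x i j
  · simp_rw [backproj_apply]
    exact integrable_finsetSum _ fun j _ => integrable_rowTerm hK hE hδ x i j

/-- Sub-Gaussian tail, at scale `K δ √m`, of one coordinate of the back-projected error. -/
theorem measure_backproj_coord_le [IsProbabilityMeasure P] (hm : 0 < m) (hK : 0 < K)
    (hE : IsSubGaussianFrame P E K) {δ : ℝ} (hδ : 0 < δ) (x : Fin k → ℝ) (i : Fin k)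
    {s : ℝ} (hs : 0 ≤ s) :
    P.real {ω | s ≤ |backproj δ (E ω) x i - (∫ ω', backproj δ (E ω') x ∂P) i|}
      ≤ 2 * Real.exp (-(s ^ 2 / (300 * K ^ 2 * δ ^ 2 * m))) := by
  have hm' : (0 : ℝ) < m := by exact_mod_cast hm
  set β := 1 / (3 * K ^ 2 * δ ^ 2) with hβ
  have hβ0 : 0 < β := by positivity
  have hrow : ∀ j, Measurable fun ω => rowTerm δ x i (row E j ω) := fun j =>
    (measurable_rowTerm δ x i).comp (hE.measurable_row j)
  have hind : iIndepFun
      (fun j ω => rowTerm δ x i (row E j ω) - ∫ ω', rowTerm δ x i (row E j ω') ∂P) P :=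
    hE.indep.comp (fun j y => rowTerm δ x i y - ∫ ω', rowTerm δ x i (row E j ω') ∂P)
      fun j => (measurable_rowTerm δ x i).sub_const _
  have hmgf := fun (t : ℝ) (j : Fin m) => mgf_sub_integral_le (hrow j) hβ0
    (integrable_exp_rowTerm_sq hK hE hδ x i j).1 (integrable_exp_rowTerm_sq hK hE hδ x i j).2 t
  -- the minimizer of `m * (25 * θ ^ 2 / β) - θ * s`
  set θ := s * β / (50 * m) with hθ
  have h := measure_le_abs_sum_le_exp hind (fun j => (hrow j).sub_const _) (θ := θ)
    (v := 25 * θ ^ 2 / β) (by positivity) (fun t _ j => (hmgf t j).1)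
    (fun t ht j => by
      rw [← ht, sq_abs]
      exact (hmgf t j).2) s
  simp_rw [integral_backproj_apply hK hE hδ x i, backproj_apply, ← Finset.sum_sub_distrib]
  refine h.trans (le_of_eq ?_)
  congr 2
  rw [hθ, hβ]
  field_simp
  ring

/-- The concentration radius is `√k` times the coordinatewise one; a union bound over the
coordinates costs the factor `√(log k)`. -/
theorem measure_deviation_le [IsProbabilityMeasure P] (hk : 3 ≤ k) (hm : 0 < m) (hK : 0 < K)
    (hE : IsSubGaussianFrame P E K) {δ : ℝ} (hδ : 0 < δ) (x : Fin k → ℝ) {c₂ : ℝ} (hc : 0 < c₂)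
    (hc1 : c₂ < 1) :
    P.real {ω | m * deviation 25 K c₂ δ (m / k) k
        ≤ ‖backproj δ (E ω) x - ∫ ω', backproj δ (E ω') x ∂P‖} ≤ c₂ := by
  have hm' : (0 : ℝ) < m := by exact_mod_cast hm
  have hk' : (3 : ℝ) ≤ k := by exact_mod_cast hk
  have hk0 : (0 : ℝ) < k := by linarith
  set L := Real.log (Real.exp 2 * c₂⁻¹) with hL
  have hL2 : L = 2 - Real.log c₂ := by
    rw [hL, Real.log_mul (Real.exp_pos _).ne' (inv_pos.2 hc).ne', Real.log_exp, Real.log_inv]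
    ring
  have hL1 : 1 ≤ L := by linarith [Real.log_neg hc hc1]
  have hlog : 1 ≤ Real.log k := by
    rw [Real.le_log_iff_exp_le hk0]
    linarith [Real.exp_one_lt_d9]
  set s := 25 * K * δ * √(m * Real.log k * L) with hs
  have hs0 : 0 < s := by positivity
  have hdev : m * deviation 25 K c₂ δ (m / k) k = √k * s := by
    have e : (m : ℝ) * (m / k : ℝ) ^ (-(1 / 2) : ℝ) = √k * √m := by
      rw [Real.rpow_neg (by positivity), ← Real.sqrt_eq_rpow, Real.sqrt_div hm'.le, inv_div]
      have : √(m : ℝ) ≠ 0 := by positivity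
      field_simp
      rw [Real.sq_sqrt hm'.le]
    rw [deviation, hs, ← hL, Real.sqrt_mul (by positivity), Real.sqrt_mul (by positivity)]
    calc _ = 25 * K * √L * √(Real.log k) * δ * ((m : ℝ) * (m / k : ℝ) ^ (-(1 / 2) : ℝ)) := by ring
      _ = _ := by rw [e]; ring
  have hsub : {ω | m * deviation 25 K c₂ δ (m / k) k
        ≤ ‖backproj δ (E ω) x - ∫ ω', backproj δ (E ω') x ∂P‖}
      ⊆ ⋃ i, {ω | s ≤ |backproj δ (E ω) x i - (∫ ω', backproj δ (E ω') x ∂P) i|} := by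
    intro ω hω
    by_contra hcon
    simp only [Set.mem_iUnion, Set.mem_ofPred_eq, not_exists, not_le] at hcon
    have h1 : ‖backproj δ (E ω) x - ∫ ω', backproj δ (E ω') x ∂P‖ ^ 2 < k * s ^ 2 := by
      rw [EuclideanSpace.norm_sq_eq]
      calc _ < ∑ _i : Fin k, s ^ 2 := by
            refine Finset.sum_lt_sum_of_nonempty ⟨⟨0, by omega⟩, Finset.mem_univ _⟩ fun i _ => ?_
            rw [Real.norm_eq_abs]
            exact pow_lt_pow_left₀ (hcon i) (abs_nonneg _) two_ne_zero
        _ = k * s ^ 2 := by simp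
    have h2 : (√k * s) ^ 2 ≤ ‖backproj δ (E ω) x - ∫ ω', backproj δ (E ω') x ∂P‖ ^ 2 := by
      rw [← hdev]
      have : 0 ≤ m * deviation 25 K c₂ δ (m / k) k := by rw [hdev]; positivity
      exact pow_le_pow_left₀ this hω 2
    rw [mul_pow, Real.sq_sqrt hk0.le] at h2
    linarith
  refine (measureReal_mono hsub).trans ((measureReal_iUnion_fintype_le _).trans ?_)
  refine (Finset.sum_le_sum fun i _ => measure_backproj_coord_le hm hK hE hδ x i hs0.le).trans ?_
  rw [Finset.sum_const, Finset.card_univ, Fintype.card_fin, nsmul_eq_mul]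
  have hexp : Real.log k + L ≤ s ^ 2 / (300 * K ^ 2 * δ ^ 2 * m) := by
    have e : s ^ 2 / (300 * K ^ 2 * δ ^ 2 * m) = 25 / 12 * (Real.log k * L) := by
      rw [hs, mul_pow, Real.sq_sqrt (by positivity)]
      field_simp
      norm_num
    -- `a + b ≤ 2 a b` whenever `a, b ≥ 1`
    rw [e]
    nlinarith
  have hexpL : Real.exp (-L) * Real.exp 2 = c₂ := by
    rw [← Real.exp_add, hL2, show -(2 - Real.log c₂) + 2 = Real.log c₂ by ring, Real.exp_log hc]
  have hk1 : (k : ℝ) * Real.exp (-Real.log k) = 1 := by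
    rw [Real.exp_neg, Real.exp_log hk0, mul_inv_cancel₀ hk0.ne']
  calc (k : ℝ) * (2 * Real.exp (-(s ^ 2 / (300 * K ^ 2 * δ ^ 2 * m))))
      ≤ k * (2 * Real.exp (-Real.log k + -L)) := by gcongr; linarith
    _ = 2 * Real.exp (-L) := by
        rw [Real.exp_add]
        linear_combination (2 * Real.exp (-L)) * hk1
    _ ≤ Real.exp 2 * Real.exp (-L) := by
        gcongr
        linarith [Real.add_one_le_exp 2]
    _ = c₂ := by rw [mul_comm, hexpL]

/-! ### Concentration of the sample covariance -/

/-- Isotropy determines the mixed second moments by polarization. -/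
theorem integral_inner_mul_inner [IsProbabilityMeasure P] {Y : Ω → EuclideanSpace ℝ (Fin k)}
    (hY : IsIsotropic P Y) (hint : ∀ v, Integrable (fun ω => inner ℝ (Y ω) v ^ 2) P)
    (u y : EuclideanSpace ℝ (Fin k)) :
    Integrable (fun ω => inner ℝ (Y ω) u * inner ℝ (Y ω) y) P ∧
      ∫ ω, inner ℝ (Y ω) u * inner ℝ (Y ω) y ∂P = inner ℝ u y := by
  have e : (fun ω => inner ℝ (Y ω) u * inner ℝ (Y ω) y)
      = fun ω => (inner ℝ (Y ω) (u + y) ^ 2 - inner ℝ (Y ω) (u - y) ^ 2) / 4 := by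
    ext ω
    rw [inner_add_right, inner_sub_right]
    ring
  rw [e]
  refine ⟨((hint _).sub (hint _)).div_const 4, ?_⟩
  rw [integral_div, integral_sub (hint _) (hint _), hY, hY, norm_add_sq_real, norm_sub_sq_real]
  ring

/-- For a fixed pair of directions the quadratic form of `covDev` has exponential tails, by the
Bernstein method. -/
theorem exists_measure_sum_inner_le (hK : 0 < K) :
    ∃ κ : ℝ, 0 < κ ∧ ∀ (Ω : Type*) [MeasurableSpace Ω] (P : Measure Ω) [IsProbabilityMeasure P]
      {m k : ℕ} (E : Ω → Matrix (Fin m) (Fin k) ℝ), IsSubGaussianFrame P E K →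
      ∀ u y : EuclideanSpace ℝ (Fin k), ‖u‖ ≤ 1 → ‖y‖ ≤ 1 → ∀ s : ℝ, 3 / 16 ≤ s →
      P.real {ω | m * s ≤ |∑ j, (inner ℝ (row E j ω) u * inner ℝ (row E j ω) y - inner ℝ u y)|}
        ≤ 2 * Real.exp (-(κ * m * s)) := by
  set c := 1 / (12 * K ^ 2) with hc
  have hc0 : 0 < c := by positivity
  set B := 16 * Real.exp c / c ^ 2 with hB
  have hB0 : 0 < B := by positivity
  -- `θ` lies in the range of the moment generating function bound, and is small enough for the
  -- quadratic term `B * θ ^ 2` to be at most half of the linear term `θ * s`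
  set θ := min (c / 2) (3 / (32 * B)) with hθ
  have hθ0 : 0 < θ := lt_min (by positivity) (by positivity)
  refine ⟨θ / 2, by positivity, ?_⟩
  intro Ω _ P _ m k E hE u y hu hy s hs
  have hmeas : ∀ j v, Measurable fun ω => inner ℝ (row E j ω) v := fun j v =>
    (hE.measurable_row j).inner measurable_const
  have hsqexp : ∀ j v, ‖v‖ ≤ 1 → _ := fun j v hv =>
    integrable_exp_inner_sq (P := P) (hE.measurable_row j) (c := c) hK
      hc0 (le_of_eq (by rw [hc]; field_simp)) (hE.psi2_le j) (u := v) hv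
  have hsq : ∀ j v, Integrable (fun ω => inner ℝ (row E j ω) v ^ 2) P := by
    intro j v
    rcases eq_or_ne v 0 with rfl | hv
    · simp
    have h1 := (integrable_sq_of_integrable_exp_sq (hmeas j _) hc0
      (hsqexp j ((‖v‖)⁻¹ • v) (by simp [norm_smul, hv])).1).const_mul (‖v‖ ^ 2)
    refine h1.congr (Filter.Eventually.of_forall fun ω => ?_)
    have : ‖v‖ ≠ 0 := norm_ne_zero_iff.2 hv
    simp only [inner_smul_right]
    field_simp
  have hX := fun j => integral_inner_mul_inner (hE.isotropic j) (hsq j) u y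
  have hXm : ∀ j, Measurable fun ω =>
      inner ℝ (row E j ω) u * inner ℝ (row E j ω) y - inner ℝ u y := fun j =>
    ((hmeas j u).mul (hmeas j y)).sub_const _
  have huy : |inner ℝ u y| ≤ 1 :=
    (abs_real_inner_le_norm u y).trans (mul_le_one₀ hu (norm_nonneg _) hy)
  have hbound : ∀ j ω, Real.exp (2 * (c / 2) *
        |inner ℝ (row E j ω) u * inner ℝ (row E j ω) y - inner ℝ u y|)
      ≤ Real.exp c / 2 * (Real.exp (c * inner ℝ (row E j ω) u ^ 2)
        + Real.exp (c * inner ℝ (row E j ω) y ^ 2)) := by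
    intro j ω
    set a := inner ℝ (row E j ω) u
    set b := inner ℝ (row E j ω) y
    have h1 : |a * b - inner ℝ u y| ≤ |a| * |b| + 1 := by
      rw [← abs_mul]
      exact (abs_sub _ _).trans (by gcongr)
    have h2 : Real.exp (2 * (c / 2) * |a * b - inner ℝ u y|)
        ≤ Real.exp c * (Real.exp (c * a ^ 2 / 2) * Real.exp (c * b ^ 2 / 2)) := by
      rw [← Real.exp_add, ← Real.exp_add]
      apply Real.exp_le_exp.2
      nlinarith [mul_nonneg hc0.le (sq_nonneg (|a| - |b|)), sq_abs a, sq_abs b,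
        mul_le_mul_of_nonneg_left h1 hc0.le]
    have h3 : Real.exp (c * a ^ 2) = Real.exp (c * a ^ 2 / 2) ^ 2 := by
      rw [← Real.exp_nat_mul]; congr 1; push_cast; ring
    have h4 : Real.exp (c * b ^ 2) = Real.exp (c * b ^ 2 / 2) ^ 2 := by
      rw [← Real.exp_nat_mul]; congr 1; push_cast; ring
    rw [h3, h4]
    refine h2.trans ?_
    have := mul_nonneg (Real.exp_pos c).le
      (sq_nonneg (Real.exp (c * a ^ 2 / 2) - Real.exp (c * b ^ 2 / 2)))
    nlinarith
  have hdom := fun j => ((hsqexp j u hu).1.add (hsqexp j y hy).1).const_mul (Real.exp c / 2)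
  have hexp : ∀ j, Integrable (fun ω => Real.exp (2 * (c / 2) *
        |inner ℝ (row E j ω) u * inner ℝ (row E j ω) y - inner ℝ u y|)) P := by
    intro j
    refine (hdom j).mono' ?_ (Filter.Eventually.of_forall fun ω => ?_)
    · have := hXm j
      exact Measurable.aestronglyMeasurable (by fun_prop)
    · rw [Real.norm_eq_abs, Real.abs_exp]
      exact hbound j ω
  have hexpM : ∀ j, ∫ ω, Real.exp (2 * (c / 2) *
        |inner ℝ (row E j ω) u * inner ℝ (row E j ω) y - inner ℝ u y|) ∂P
        ≤ 2 * Real.exp c := by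
    intro j
    refine (integral_mono (hexp j) (hdom j) (hbound j)).trans ?_
    have h1 := (hsqexp j u hu).2
    have h2 := (hsqexp j y hy).2
    simp only [Pi.add_apply]
    rw [integral_const_mul, integral_add (hsqexp j u hu).1 (hsqexp j y hy).1]
    nlinarith [Real.exp_pos c]
  have hmgf := fun (t : ℝ) (ht : |t| ≤ θ) (j : Fin m) =>
    mgf_le_of_integral_exp_abs_le (hXm j) ((hX j).1.sub (integrable_const _))
      (by
        rw [integral_sub (hX j).1 (integrable_const _), (hX j).2]
        simp)
      (by positivity : 0 < c / 2) (hexp j) (hexpM j) (ht.trans (min_le_left _ _))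
  have hind : iIndepFun (fun j ω =>
      inner ℝ (row E j ω) u * inner ℝ (row E j ω) y - inner ℝ u y) P :=
    hE.indep.comp (fun _ v => inner ℝ v u * inner ℝ v y - inner ℝ u y) fun _ => by fun_prop
  have h := measure_le_abs_sum_le_exp hind hXm (θ := θ) (v := B * θ ^ 2) hθ0.le
    (fun t ht j => (hmgf t ht j).1)
    (fun t ht j => by
      refine (hmgf t ht.le j).2.trans (le_of_eq ?_)
      rw [← ht, sq_abs, hB]
      congr 1
      field_simp
      ring) (m * s)
  refine h.trans ?_
  gcongr
  have h1 : B * θ ≤ s / 2 := by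
    have : B * θ ≤ B * (3 / (32 * B)) := by gcongr; exact min_le_right _ _
    have e : B * (3 / (32 * B)) = 3 / 32 := by field_simp
    linarith
  have h2 : m * (B * θ * θ) ≤ m * (s / 2 * θ) := by gcongr
  linarith

/-- The sample covariance is within `3 / 4 + L k / m` of the identity, except with probability
exponentially small in `m`; the term `L k / m` pays for the union bound over pairs of points of a
net. -/
theorem exists_measure_norm_covDev_le (hK : 0 < K) :
    ∃ L c₃ : ℝ, 0 < L ∧ 0 < c₃ ∧ ∀ (Ω : Type*) [MeasurableSpace Ω] (P : Measure Ω)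
      [IsProbabilityMeasure P] {m k : ℕ} (E : Ω → Matrix (Fin m) (Fin k) ℝ), 0 < m →
      IsSubGaussianFrame P E K →
      P.real {ω | 3 / 4 + L * (k / m) < ‖covDev (E ω)‖} ≤ 2 * Real.exp (-c₃ * m) := by
  obtain ⟨κ, hκ, H⟩ := exists_measure_sum_inner_le hK
  refine ⟨16 / κ, 3 / 16 * κ, by positivity, by positivity, ?_⟩
  intro Ω _ P _ m k E hm hE
  have hm' : (0 : ℝ) < m := by exact_mod_cast hm
  obtain ⟨N, hcard, hN1, hN⟩ := exists_net (F := EuclideanSpace ℝ (Fin k))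
  rw [finrank_euclideanSpace_fin] at hcard
  set s := 3 / 16 + 4 / κ * (k / m) with hs
  have hs1 : 3 / 16 ≤ s := by
    have : 0 ≤ 4 / κ * (k / m : ℝ) := by positivity
    linarith
  have hsub : {ω | 3 / 4 + 16 / κ * (k / m) < ‖covDev (E ω)‖} ⊆ ⋃ q ∈ N ×ˢ N,
      {ω | m * s ≤ |∑ j, (inner ℝ (row E j ω) q.1 * inner ℝ (row E j ω) q.2
        - inner ℝ q.1 q.2)|} := by
    intro ω hω
    by_contra hcon
    simp only [Set.mem_iUnion, Set.mem_ofPred_eq, not_exists, not_le, exists_prop, not_and]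
      at hcon
    have h1 : ‖covDev (E ω)‖ ≤ 4 * s := by
      refine opNorm_le_of_net hN _ (by linarith) fun u hu y hy => ?_
      have h2 := hcon (u, y) (Finset.mem_product.2 ⟨hu, hy⟩)
      have h3 := inner_covDev hm (E ω) u y
      change |∑ j, (inner ℝ (WithLp.toLp 2 (E ω j)) u * inner ℝ (WithLp.toLp 2 (E ω j)) y
        - inner ℝ u y)| < m * s at h2
      rw [← h3, abs_mul, abs_of_pos hm'] at h2
      exact (lt_of_mul_lt_mul_left h2 hm'.le).le
    have h4 : 4 * s = 3 / 4 + 16 / κ * (k / m) := by rw [hs]; ring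
    rw [Set.mem_ofPred_eq] at hω
    linarith
  refine (measureReal_mono hsub (measure_ne_top _ _)).trans
    ((measureReal_biUnion_finset_le _ _).trans ?_)
  refine (Finset.sum_le_sum fun q hq => H Ω P E hE q.1 q.2 (hN1 _ (Finset.mem_product.1 hq).1)
    (hN1 _ (Finset.mem_product.1 hq).2) s hs1).trans ?_
  rw [Finset.sum_const, Finset.card_product, nsmul_eq_mul]
  have h25 : ((N.card * N.card : ℕ) : ℝ) ≤ Real.exp (4 * k) := by
    have h5 : (5 : ℝ) ≤ Real.exp 2 := by
      have := Real.exp_one_gt_d9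
      rw [show (2 : ℝ) = 1 + 1 by norm_num, Real.exp_add]
      nlinarith
    have h6 : (N.card : ℝ) ≤ Real.exp (2 * k) := by
      calc (N.card : ℝ) ≤ 5 ^ k := by exact_mod_cast hcard
        _ ≤ Real.exp 2 ^ k := by gcongr
        _ = Real.exp (2 * k) := by rw [← Real.exp_nat_mul, mul_comm]
    push_cast
    calc (N.card : ℝ) * N.card ≤ Real.exp (2 * k) * Real.exp (2 * k) := by gcongr
      _ = Real.exp (4 * k) := by rw [← Real.exp_add]; congr 1; ring
  calc ((N.card * N.card : ℕ) : ℝ) * (2 * Real.exp (-(κ * m * s)))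
      ≤ Real.exp (4 * k) * (2 * Real.exp (-(κ * m * s))) := by gcongr
    _ = 2 * Real.exp (-(3 / 16 * κ) * m) := by
        rw [mul_left_comm, ← Real.exp_add, hs]
        congr 2
        field_simp
        ring

end Random

/-! ### The constants of the error bounds -/

theorem sq_sqrt_mul_rpow {L lam : ℝ} (hL : 0 ≤ L) (hlam : 0 ≤ lam) :
    (√L * lam ^ (-(1 / 2) : ℝ)) ^ 2 = L / lam := by
  rw [Real.rpow_neg hlam, ← Real.sqrt_eq_rpow, mul_pow, inv_pow, Real.sq_sqrt hL,
    Real.sq_sqrt hlam, div_eq_mul_inv]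

/-- With `q = √L * lam ^ (-1 / 2)`, the claim is `1 + (3 / 4 + q ^ 2) ≤ (3 / 2 + q) ^ 2`. -/
theorem lowerConst_mul_le {L lam : ℝ} (hL : 0 < L) (hlam : 0 < lam) :
    lowerConst (√L) lam * (1 + (3 / 4 + L / lam)) ≤ 1 := by
  set q := √L * lam ^ (-(1 / 2) : ℝ) with hq
  have hq0 : 0 < q := by positivity
  have hq2 : q ^ 2 = L / lam := by
    exact sq_sqrt_mul_rpow hL.le hlam.le
  rw [lowerConst, ← hq, ← hq2, zpow_neg, inv_mul_le_iff₀ (by positivity)]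
  norm_cast
  nlinarith

/-- With `q = √L * lam ^ (-1 / 2) < 1 / 2`, the claim is
`(1 / 2 - q) ^ 2 ≤ 1 - (3 / 4 + q ^ 2)`. -/
theorem one_le_upperConst_mul {L lam : ℝ} (hL : 0 < L) (hlam : (2 * √L) ^ 2 < lam) :
    0 < 1 - (3 / 4 + L / lam) ∧ 1 ≤ upperConst (√L) lam * (1 - (3 / 4 + L / lam)) := by
  have hlam0 : 0 < lam := lt_of_le_of_lt (sq_nonneg _) hlam
  set q := √L * lam ^ (-(1 / 2) : ℝ) with hq
  have hq0 : 0 < q := by positivity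
  have hq2 : q ^ 2 = L / lam := by
    exact sq_sqrt_mul_rpow hL.le hlam0.le
  have hq1 : q < 1 / 2 := by
    have : q ^ 2 < (1 / 2) ^ 2 := by
      rw [hq2, div_lt_iff₀ hlam0]
      rw [mul_pow, Real.sq_sqrt hL.le] at hlam
      linarith
    exact lt_of_pow_lt_pow_left₀ 2 (by norm_num) this
  have hpos : 0 < 1 / 2 - q := by linarith
  rw [upperConst, ← hq, ← hq2, zpow_neg]
  refine ⟨by nlinarith, ?_⟩
  rw [inv_mul_eq_div, le_div_iff₀ (by positivity)]
  norm_cast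
  nlinarith

end MSQ

/-! ### The reconstruction error -/

theorem mainTheorem1 :
    ∃ C : ℝ, 0 < C ∧
      ∀ K : ℝ, 0 < K →
        ∃ cK c₃ : ℝ, 0 < cK ∧ 0 < c₃ ∧
          ∀ (k m : ℕ) (lam : ℝ), 3 ≤ k → lam = (m : ℝ) / (k : ℝ) → 1 < lam →
          ∀ (δ : ℝ), 0 < δ →
          ∀ (x : Fin k → ℝ)
            (Ω : Type*) [MeasurableSpace Ω] (P : Measure Ω) [IsProbabilityMeasure P]
            (E : Ω → Matrix (Fin m) (Fin k) ℝ), MSQ.IsSubGaussianFrame P E K →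
          ∀ c₂ : ℝ, 0 < c₂ → c₂ < 1 →
            1 - c₂ - 2 * Real.exp (-c₃ * m) ≤
              P.real {ω |
                ((E ω).rank = k →
                  MSQ.lowerConst cK lam * (MSQ.bias P δ E x - MSQ.deviation C K c₂ δ lam k)
                    < MSQ.reconError δ (E ω) x) ∧
                ((2 * cK) ^ 2 < lam →
                  (E ω).rank = k ∧
                  MSQ.reconError δ (E ω) x
                    < MSQ.upperConst cK lam *
                        (MSQ.bias P δ E x + MSQ.deviation C K c₂ δ lam k))} := by
  refine ⟨25, by norm_num, fun K hK => ?_⟩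
  obtain ⟨L, c₃, hL, hc₃, hcov⟩ := MSQ.exists_measure_norm_covDev_le hK
  -- `c_K = √L` makes `L / λ` the square of `c_K λ ^ (-1 / 2)`
  refine ⟨√L, c₃, by positivity, hc₃, ?_⟩
  rintro k m lam hk rfl hlam δ hδ x Ω _ P _ E hE c₂ hc₂ hc₂1
  have hk0 : (0 : ℝ) < k := by exact_mod_cast (by omega : 0 < k)
  have hm' : (0 : ℝ) < m := by
    rw [one_lt_div hk0] at hlam
    exact hk0.trans hlam
  have hm : 0 < m := by exact_mod_cast hm'
  set lam : ℝ := m / k with hlam_def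
  have hlam0 : 0 < lam := by positivity
  have hLlam : L * (k / m) = L / lam := by rw [hlam_def]; field_simp
  set dev := MSQ.deviation 25 K c₂ δ lam k with hdev
  set μ := MSQ.bias P δ E x with hμ
  set w := ∫ ω, MSQ.backproj δ (E ω) x ∂P with hw
  have hμw : m * μ = ‖w‖ := by
    have e : μ = 1 / (m : ℝ) * ‖w‖ := rfl
    rw [e]
    field_simp
  set bad₁ := {ω | m * dev ≤ ‖MSQ.backproj δ (E ω) x - w‖} with hbad₁
  set bad₂ := {ω | 3 / 4 + L * (k / m) < ‖MSQ.covDev (E ω)‖} with hbad₂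
  set t := 3 / 4 + L / lam with ht
  have ht0 : 0 < t := by positivity
  have hp₁ : P.real bad₁ ≤ c₂ := MSQ.measure_deviation_le hk hm hK hE hδ x hc₂ hc₂1
  have hp₂ : P.real bad₂ ≤ 2 * Real.exp (-c₃ * m) := hcov Ω P E hm hE
  have hgood : ∀ ω, ω ∉ bad₁ → ω ∉ bad₂ →
      ((E ω).rank = k → MSQ.lowerConst √L lam * (μ - dev) < MSQ.reconError δ (E ω) x) ∧
      ((2 * √L) ^ 2 < lam → (E ω).rank = k ∧
        MSQ.reconError δ (E ω) x < MSQ.upperConst √L lam * (μ + dev)) := by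
    intro ω h₁ h₂
    rw [hbad₁, Set.mem_ofPred_eq, not_le] at h₁
    rw [hbad₂, Set.mem_ofPred_eq, not_lt, hLlam] at h₂
    have hr : 0 ≤ MSQ.reconError δ (E ω) x := norm_nonneg _
    constructor
    · intro hrank
      have hA : 0 < MSQ.lowerConst √L lam := by unfold MSQ.lowerConst; positivity
      have h3 := MSQ.norm_backproj_le (δ := δ) hm hrank h₂ x
      rw [← ht] at h3
      have h4 : ‖w‖ - ‖MSQ.backproj δ (E ω) x‖ ≤ ‖MSQ.backproj δ (E ω) x - w‖ := by
        rw [norm_sub_rev]; exact norm_sub_norm_le _ _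
      have h5 : m * (μ - dev) < m * ((1 + t) * MSQ.reconError δ (E ω) x) := by
        linarith
      calc MSQ.lowerConst √L lam * (μ - dev)
          < MSQ.lowerConst √L lam * ((1 + t) * MSQ.reconError δ (E ω) x) :=
            mul_lt_mul_of_pos_left (lt_of_mul_lt_mul_left h5 hm'.le) hA
        _ = MSQ.lowerConst √L lam * (1 + t) * MSQ.reconError δ (E ω) x := by ring
        _ ≤ MSQ.reconError δ (E ω) x :=
            mul_le_of_le_one_left hr (MSQ.lowerConst_mul_le hL hlam0)
    · intro hbig
      obtain ⟨ht1, hA⟩ := MSQ.one_le_upperConst_mul hL hbig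
      have hA0 : 0 < MSQ.upperConst √L lam := by
        by_contra hneg
        nlinarith [not_lt.1 hneg]
      have hrank : (E ω).rank = k :=
        MSQ.rank_eq_of_norm_covDev_lt_one hm (h₂.trans_lt (by linarith))
      refine ⟨hrank, ?_⟩
      have h3 := MSQ.le_norm_backproj (δ := δ) hm hrank h₂ x
      rw [← ht] at h3
      have h4 := norm_sub_norm_le (MSQ.backproj δ (E ω) x) w
      have h5 : m * ((1 - t) * MSQ.reconError δ (E ω) x) < m * (μ + dev) := by
        linarith
      calc MSQ.reconError δ (E ω) x
          ≤ MSQ.upperConst √L lam * (1 - t) * MSQ.reconError δ (E ω) x :=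
            le_mul_of_one_le_left hr hA
        _ = MSQ.upperConst √L lam * ((1 - t) * MSQ.reconError δ (E ω) x) := by ring
        _ < MSQ.upperConst √L lam * (μ + dev) :=
            mul_lt_mul_of_pos_left (lt_of_mul_lt_mul_left h5 hm'.le) hA0
  -- the good event need not be measurable, so subadditivity is used instead of complements
  set good := {ω | ((E ω).rank = k →
        MSQ.lowerConst √L lam * (μ - dev) < MSQ.reconError δ (E ω) x) ∧
      ((2 * √L) ^ 2 < lam → (E ω).rank = k ∧
        MSQ.reconError δ (E ω) x < MSQ.upperConst √L lam * (μ + dev))} with hgood_def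
  have hcover : (Set.univ : Set Ω) ⊆ good ∪ (bad₁ ∪ bad₂) := by
    intro ω _
    by_cases h₁ : ω ∈ bad₁
    · exact Or.inr (Or.inl h₁)
    by_cases h₂ : ω ∈ bad₂
    · exact Or.inr (Or.inr h₂)
    · exact Or.inl (hgood ω h₁ h₂)
  have h1 : 1 ≤ P.real good + (P.real bad₁ + P.real bad₂) := by
    calc (1 : ℝ) = P.real Set.univ := by simp
      _ ≤ P.real (good ∪ (bad₁ ∪ bad₂)) := measureReal_mono hcover
      _ ≤ _ := (measureReal_union_le _ _).trans (by gcongr; exact measureReal_union_le _ _)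
  linarith
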